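/- Let $n,k\ge 0$, let $f=\{f_1,\dots,f_k\}$ be polynomials in $\mathbb{R}[x_1,\dots,x_n]$, let $\beta>0$ be a real constant, and let $h=\{h_1,\dots,h_k\}$ with $h_i=f_i+w_i/\sqrt{\beta}\in\mathbb{R}[x_1,\dots,x_n,w_1,\dots,w_k]$. Then the real zero set $M=V_{\mathbb{R}}(h)\subset\mathbb{R}^{n+k}$ is a smooth embedded $n$-dimensional submanifold, and it has a tubular neighborhood $U\subset\mathbb{R}^{n+k}$ with the properties (1) and (2) below. Here a tubular neighborhood of $M$ is an open set $U\supseteq M$ that is the diffeomorphic image, under $E(p,v)=p+v$, of $\{(p,v)\in NM:\|v\|_2<\delta(p)\}$ for some positive continuous function $\delta:M\to\mathbb{R}$, where $NM=\{(p,v): p\in M,\ v\perp T_pM\}$ is the normal bundle of $M$. For every point $(\mathfrak{a},b)\in U$ (with $\mathfrak{a}\in\mathbb{R}^n$, $b\in\mathbb{R}^k$): (1) there is a unique point $(x^*,w^*)\in V_{\mathbb{R}}(h)$ at minimum Euclidean distance from $(\mathfrak{a},b)$; (2) $(x^*,w^*)$ is the projection of a unique zero $(x^*,w^*,\lambda^*)$,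 $\lambda^*\in\mathbb{R}^k$, of the Lagrange system of the problem $\min\ (\|x-\mathfrak{a}\|_2^2+\|w-b\|_2^2)/2$ subject to $h=0$, that is, of the system of $n+2k$ polynomial equations in the unknowns $(x,w,\lambda)$ $$\begin{pmatrix}x-\mathfrak{a}\\ w-b\end{pmatrix}=\sum_{j=1}^k\lambda_j\,\nabla h_j(x,w),\qquad h_1(x,w)=\dots=h_k(x,w)=0,$$ and this zero is isolated (even in the set of complex zeros of the system) and simple (the Jacobian matrix of the system is nonsingular there). -/

import Mathlib

open scoped ContDiff Topology

noncomputable section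

/-! ### Submanifolds of a Euclidean space and tubular neighborhoods -/

section Geometry

variable {E : Type*} [NormedAddCommGroup E] [InnerProductSpace ℝ E]

/-- `M ⊆ E` is a smooth embedded submanifold of dimension `d`: around each of its points there is
a smooth chart of the ambient space `E` in which `M` is a slice, that is, the intersection of the
domain with a `d`-dimensional linear subspace. -/
def IsEmbeddedSubmanifold (d : ℕ) (M : Set E) : Prop :=
  ∀ p ∈ M, ∃ (φ : OpenPartialHomeomorph E E) (S : Submodule ℝ E),
    p ∈ φ.source ∧ ContDiffOn ℝ ∞ φ φ.source ∧ ContDiffOn ℝ ∞ φ.symm φ.target ∧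
      Module.finrank ℝ S = d ∧ ∀ q ∈ φ.source, q ∈ M ↔ φ q ∈ S

/-- `u` is tangent to `M` at `p`: it is the velocity at time `0` of a smooth curve in `M`
through `p`. -/
def IsTangentVector (M : Set E) (p u : E) : Prop :=
  ∃ (γ : ℝ → E) (ε : ℝ), 0 < ε ∧ ContDiffOn ℝ ∞ γ (Set.Ioo (-ε) ε) ∧
    (∀ t ∈ Set.Ioo (-ε) ε, γ t ∈ M) ∧ γ 0 = p ∧ HasDerivAt γ u 0

/-- The normal space `N_p M`: all vectors orthogonal to the tangent space of `M` at `p`. -/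
def normalSpace (M : Set E) (p : E) : Submodule ℝ E :=
  (Submodule.span ℝ {u | IsTangentVector M p u})ᗮ

/-- The normal bundle `NM = {(p, v) | p ∈ M, v ∈ N_p M}`, as a subset of `TE = E × E`. -/
def normalBundle (M : Set E) : Set (E × E) :=
  {q | q.1 ∈ M ∧ q.2 ∈ normalSpace M q.1}

/-- The open subset `{(p, v) ∈ NM | ‖v‖ < δ p}` of the normal bundle. -/
def normalTube (M : Set E) (δ : E → ℝ) : Set (E × E) :=
  {q | q ∈ normalBundle M ∧ ‖q.2‖ < δ q.1}

/-- `U` is a tubular neighborhood of `M`: an open set containing `M` that is the diffeomorphic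
image, under `(p, v) ↦ p + v`, of the tube `{(p, v) ∈ NM | ‖v‖ < δ p}` for some positive
continuous function `δ` on `M`.

The map `(p, v) ↦ p + v` is smooth on all of `E × E`, so it is a diffeomorphism from the tube
onto `U` when it is a bijection between the two whose inverse `G` is smooth. Here `G` is smooth as
a map from the open set `U` to the ambient space `E × E` of the normal bundle, which is the same
as being smooth as a map into the embedded submanifold `NM`. -/
def IsTubularNeighborhood (M U : Set E) : Prop :=
  IsOpen U ∧ M ⊆ U ∧
    ∃ δ : E → ℝ, ContinuousOn δ M ∧ (∀ p ∈ M, 0 < δ p) ∧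
      Set.BijOn (fun q : E × E => q.1 + q.2) (normalTube M δ) U ∧
      ∃ G : E → E × E, ContDiffOn ℝ ∞ G U ∧
        Set.InvOn G (fun q : E × E => q.1 + q.2) (normalTube M δ) U

/-- `p` is a point of `M` at minimum distance to `c`. -/
def IsClosestPoint (M : Set E) (c p : E) : Prop :=
  p ∈ M ∧ ∀ q ∈ M, dist c p ≤ dist c q

end Geometry

/-! ### Polynomial systems -/

section Systems

variable {σ ι : Type*}

/-- `z` is a common zero, with coordinates in `K`, of the real polynomials `F i`. -/
def IsZeroOf (K : Type*) [CommRing K] [Algebra ℝ K]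
    (F : ι → MvPolynomial σ ℝ) (z : σ → K) : Prop :=
  ∀ i, MvPolynomial.aeval z (F i) = 0

/-- `V_ℝ(F)`, the real zero set of `F`, in Euclidean space. -/
def realZeroSet (F : ι → MvPolynomial σ ℝ) : Set (EuclideanSpace ℝ σ) :=
  {p | IsZeroOf ℝ F (fun s => p s)}

/-- The real zero `z` is isolated, even among the complex zeros of the system. -/
def IsIsolatedZero (F : ι → MvPolynomial σ ℝ) (z : σ → ℝ) : Prop :=
  IsZeroOf ℝ F z ∧
    ∀ᶠ y in 𝓝 (fun s => (z s : ℂ)), IsZeroOf ℂ F y → y = fun s => (z s : ℂ)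

/-- The zero `z` of a square system is simple: the Jacobian matrix is nonsingular at `z`. -/
def IsSimpleZero [Fintype σ] [DecidableEq σ]
    (F : σ → MvPolynomial σ ℝ) (z : σ → ℝ) : Prop :=
  IsZeroOf ℝ F z ∧
    (Matrix.of fun i j => MvPolynomial.eval z (MvPolynomial.pderiv j (F i))).det ≠ 0

/-- The Lagrange system of the problem `min ‖y - c‖² / 2` subject to `h = 0`, in the variables `y`
(indexed by `σ`) and the multipliers `lam` (indexed by `ι`): the equations
`y_s - c_s = ∑ j, (∂h_j / ∂y_s) lam_j` for all `s`, and `h_j(y) = 0` for all `j`. -/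
def lagrangeSystem [Fintype ι] (h : ι → MvPolynomial σ ℝ) (c : σ → ℝ) :
    σ ⊕ ι → MvPolynomial (σ ⊕ ι) ℝ
  | Sum.inl s => MvPolynomial.X (Sum.inl s) - MvPolynomial.C (c s) -
      ∑ j, MvPolynomial.rename Sum.inl (MvPolynomial.pderiv s (h j)) *
        MvPolynomial.X (Sum.inr j)
  | Sum.inr j => MvPolynomial.rename Sum.inl (h j)

/-- The system `h_i = f_i + w_i / √β` in the variables `x_1, …, x_n` (the left summand) and
`w_1, …, w_k` (the right summand). -/
def slackSystem {n k : ℕ} (f : Fin k → MvPolynomial (Fin n) ℝ) (β : ℝ) :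
    Fin k → MvPolynomial (Fin n ⊕ Fin k) ℝ :=
  fun i => MvPolynomial.rename Sum.inl (f i) +
    MvPolynomial.C (1 / √β) * MvPolynomial.X (Sum.inr i)

end Systems

end

/-!
The slack variables make the Jacobian matrix of `h` of full rank at every point, so the regular
zero set of a smooth `g : E → F` is the right setting. A point of the tube has the form
`c = p - (D g p)† λ` with `g p = 0`, that is, `L (p, λ) = (c, 0)` for the Lagrange map
`L (y, λ) = (y - (D g y)† λ, g y)`, which does not involve `c`. When `λ` is small compared with
`D²g`, two things happen: Taylor's formula shows that `p` is the strictly closest zero of `g`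
to `c`, and `D L (p, λ)` is injective. The first makes `(p, v) ↦ p + v` injective on the tube; the
second provides, by the inverse function theorem for `L`, a smooth local foot point map, hence
openness of the tube's image and smoothness of the inverse. A continuous bound on `D²g` over unit
balls and a right inverse of `D g` that depends continuously on the point turn the smallness of `λ`
into a continuous radius `δ p`. In coordinates `L - (c, 0)` is the Lagrange system, so injectivity
of `D L` says that the zero is simple; its nonsingular real Jacobian matrix stays nonsingular
over `ℂ`, which isolates the zero among the complex ones.
-/

noncomputable section

open scoped InnerProduct

section LinearAlgebra

theorem isInvertible_of_injective {𝕜 G : Type*} [NontriviallyNormedField 𝕜] [CompleteSpace 𝕜]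
    [NormedAddCommGroup G] [NormedSpace 𝕜 G] [FiniteDimensional 𝕜 G] {A : G →L[𝕜] G}
    (hA : Function.Injective A) : A.IsInvertible :=
  ⟨(LinearEquiv.ofInjectiveEndo (A : G →ₗ[𝕜] G) hA).toContinuousLinearEquiv, rfl⟩

variable {𝕜 E F : Type*} [RCLike 𝕜] [NormedAddCommGroup E] [InnerProductSpace 𝕜 E]
  [CompleteSpace E] [NormedAddCommGroup F] [InnerProductSpace 𝕜 F]

variable [CompleteSpace F] [FiniteDimensional 𝕜 F]

theorem injective_adjoint_iff_surjective {A : E →L[𝕜] F} :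
    Function.Injective (A†) ↔ Function.Surjective A := by
  have hker : Function.Injective (A†) ↔ A†.ker = ⊥ := LinearMap.ker_eq_bot.symm
  have hrange : Function.Surjective A ↔ A.range = ⊤ := LinearMap.range_eq_top.symm
  rw [hker, hrange, ← A.orthogonal_range, Submodule.orthogonal_eq_bot_iff]

theorem orthogonal_ker_eq_range_adjoint (A : E →L[𝕜] F) : A.kerᗮ = A†.range := by
  rw [A.orthogonal_ker]
  exact (Submodule.closed_of_finiteDimensional _).submodule_topologicalClosure_eq

/-- The Moore–Penrose right inverse `A† (A A†)⁻¹` of a surjective operator `A`. It is used because,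
unlike an arbitrary right inverse, it depends continuously on `A`. If `A` is not surjective, its
value is `0`. -/
def penroseRightInverse (A : E →L[𝕜] F) : F →L[𝕜] E :=
  A† ∘L (A ∘L A†).inverse

theorem isInvertible_comp_adjoint {A : E →L[𝕜] F} (hA : Function.Surjective A) :
    (A ∘L A†).IsInvertible :=
  isInvertible_of_injective <| A.self_comp_adjoint_injective_iff.2 <|
    injective_adjoint_iff_surjective.2 hA

theorem comp_penroseRightInverse {A : E →L[𝕜] F} (hA : Function.Surjective A) :
    A ∘L penroseRightInverse A = .id 𝕜 F :=
  (isInvertible_comp_adjoint hA).self_comp_inverse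

theorem continuousAt_penroseRightInverse {A : E →L[𝕜] F}
    (hA : Function.Surjective A) :
    ContinuousAt (penroseRightInverse : (E →L[𝕜] F) → F →L[𝕜] E) A := by
  have hadj : Continuous fun B : E →L[𝕜] F => B† := ContinuousLinearMap.adjoint.continuous
  have hgram : Continuous fun B : E →L[𝕜] F => B ∘L B† := continuous_id.clm_comp hadj
  have hinv := (isInvertible_comp_adjoint hA).contDiffAt_map_inverse (n := 0)
  exact hadj.continuousAt.clm_comp
    (ContinuousAt.comp (g := ContinuousLinearMap.inverse) hinv.continuousAt hgram.continuousAt)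

theorem norm_le_penroseRightInverse_mul_norm_adjoint {A : E →L[𝕜] F}
    (hA : Function.Surjective A) (lam : F) : ‖lam‖ ≤ ‖penroseRightInverse A‖ * ‖(A†) lam‖ := by
  have hleft : ((penroseRightInverse A)†) ((A†) lam) = lam := by
    rw [← ContinuousLinearMap.comp_apply, ← ContinuousLinearMap.adjoint_comp,
      comp_penroseRightInverse hA, ContinuousLinearMap.adjoint_id, ContinuousLinearMap.id_apply]
  calc ‖lam‖ = ‖((penroseRightInverse A)†) ((A†) lam)‖ := by rw [hleft]
    _ ≤ ‖((penroseRightInverse A)†)‖ * ‖(A†) lam‖ := ContinuousLinearMap.le_opNorm _ _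
    _ = ‖penroseRightInverse A‖ * ‖(A†) lam‖ := by rw [LinearIsometryEquiv.norm_map]

end LinearAlgebra

section InverseFunction

variable {G H : Type*} [NormedAddCommGroup G] [NormedSpace ℝ G] [CompleteSpace G]
  [NormedAddCommGroup H] [NormedSpace ℝ H]

theorem exists_openPartialHomeomorph_contDiffOn_symm {f : G → H} {z : G} (hf : ContDiff ℝ ∞ f)
    (hz : (fderiv ℝ f z).IsInvertible) :
    ∃ Φ : OpenPartialHomeomorph G H,
      z ∈ Φ.source ∧ ⇑Φ = f ∧ ContDiffOn ℝ ∞ Φ.symm Φ.target := by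
  have hderiv (y : G) : HasFDerivAt f (fderiv ℝ f y) y :=
    (hf.differentiable (by simp) y).hasFDerivAt
  let V : Set G := {y | (fderiv ℝ f y).IsInvertible}
  have hV : IsOpen V :=
    ContinuousLinearEquiv.isOpen.preimage (hf.continuous_fderiv (by simp))
  obtain ⟨e, he⟩ := hz
  let Φ := hf.contDiffAt.toOpenPartialHomeomorph f (he ▸ hderiv z) (by simp)
  refine ⟨Φ.restrOpen V hV, ⟨hf.contDiffAt.mem_toOpenPartialHomeomorph_source _ _, ⟨e, he⟩⟩, rfl,
    fun y hy => ContDiffAt.contDiffWithinAt ?_⟩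
  obtain ⟨e', he'⟩ := ((Φ.restrOpen V hV).map_target hy).2
  exact (Φ.restrOpen V hV).contDiffAt_symm hy (he' ▸ hderiv _) hf.contDiffAt

end InverseFunction

section ZeroSet

variable {E F : Type*} [NormedAddCommGroup E] [NormedSpace ℝ E] [CompleteSpace E]
  [NormedAddCommGroup F] [NormedSpace ℝ F] [FiniteDimensional ℝ F] {g : E → F} {p : E}

theorem exists_chart_of_surjective_fderiv (hg : ContDiff ℝ ∞ g)
    (hp : Function.Surjective (fderiv ℝ g p)) :
    ∃ Φ : OpenPartialHomeomorph E E, p ∈ Φ.source ∧ ContDiffOn ℝ ∞ Φ Φ.source ∧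
      ContDiffOn ℝ ∞ Φ.symm Φ.target ∧ HasFDerivAt Φ (.id ℝ E) p ∧
      ∀ q, g q = 0 ↔ Φ q ∈ (fderiv ℝ g p).ker := by
  set A := fderiv ℝ g p
  obtain ⟨R, hR⟩ := A.exists_rightInverse_of_surjective (LinearMap.range_eq_top.2 hp)
  -- The correction along `R` replaces `A q` by `g q` and vanishes to first order at `p`.
  let φ : E → E := fun q => q + R (g q - A q)
  have hφ : ContDiff ℝ ∞ φ := by fun_prop
  have hφ' : HasFDerivAt φ (.id ℝ E) p := by
    have hgA : HasFDerivAt (fun q => g q - A q) (A - A) p :=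
      (hg.differentiable (by simp) p).hasFDerivAt.sub A.hasFDerivAt
    refine ((hasFDerivAt_id p).add (R.hasFDerivAt.comp p hgA)).congr_fderiv ?_
    rw [sub_self, ContinuousLinearMap.comp_zero, add_zero]
  have hAφ (q : E) : A (φ q) = g q := by
    have hAR (y : F) : A (R y) = y := DFunLike.congr_fun hR y
    rw [map_add, hAR, add_sub_cancel]
  obtain ⟨Φ, hpΦ, hΦ, hsymm⟩ := exists_openPartialHomeomorph_contDiffOn_symm hφ
    (z := p) (by rw [hφ'.fderiv]; exact ⟨.refl ℝ E, rfl⟩)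
  refine ⟨Φ, hpΦ, hΦ ▸ hφ.contDiffOn, hsymm, hΦ ▸ hφ', fun q => ?_⟩
  rw [hΦ, LinearMap.mem_ker, ContinuousLinearMap.coe_coe, hAφ]

end ZeroSet

section Submanifold

variable {E F : Type*} [NormedAddCommGroup E] [InnerProductSpace ℝ E] [CompleteSpace E]
  [NormedAddCommGroup F]

section

variable [NormedSpace ℝ F] [FiniteDimensional ℝ F] {g : E → F} {p : E}

theorem isEmbeddedSubmanifold_zeroSet [FiniteDimensional ℝ E] {d : ℕ} (hg : ContDiff ℝ ∞ g)
    (hreg : ∀ p, g p = 0 → Function.Surjective (fderiv ℝ g p))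
    (hd : d + Module.finrank ℝ F = Module.finrank ℝ E) :
    IsEmbeddedSubmanifold d {q | g q = 0} := by
  intro p hp
  obtain ⟨Φ, hpΦ, hΦ, hsymm, -, hzero⟩ := exists_chart_of_surjective_fderiv hg (hreg p hp)
  refine ⟨Φ, (fderiv ℝ g p).ker, hpΦ, hΦ, hsymm, ?_, fun q _ => hzero q⟩
  have hrank := (fderiv ℝ g p : E →ₗ[ℝ] F).finrank_range_add_finrank_ker
  rw [LinearMap.range_eq_top.2 (hreg p hp), finrank_top] at hrank
  lia

theorem isTangentVector_zeroSet_iff (hg : ContDiff ℝ ∞ g) (hp : g p = 0)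
    (hreg : Function.Surjective (fderiv ℝ g p)) {u : E} :
    IsTangentVector {q | g q = 0} p u ↔ fderiv ℝ g p u = 0 := by
  constructor
  · rintro ⟨γ, ε, hε, -, hγM, rfl, hγ⟩
    have hgγ : HasDerivAt (g ∘ γ) (fderiv ℝ g (γ 0) u) 0 :=
      (hg.differentiable (by simp) _).hasFDerivAt.comp_hasDerivAt 0 hγ
    have hconst : g ∘ γ =ᶠ[𝓝 0] fun _ => 0 := by
      filter_upwards [Ioo_mem_nhds (neg_lt_zero.2 hε) hε] with t ht using hγM t ht
    exact hgγ.unique ((hasDerivAt_const 0 0).congr_of_eventuallyEq hconst)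
  · intro hu
    obtain ⟨Φ, hpΦ, -, hsymm, hderiv, hzero⟩ := exists_chart_of_surjective_fderiv hg hreg
    let line : ℝ → E := fun t => Φ p + t • u
    have hline : ContDiff ℝ ∞ line := by fun_prop
    have hline0 : line 0 = Φ p := by simp [line]
    have hline' : HasDerivAt line u 0 := by
      have := ((hasDerivAt_id (0 : ℝ)).smul_const u).const_add (Φ p)
      rwa [one_smul] at this
    have htarget : line ⁻¹' Φ.target ∈ 𝓝 0 := by
      refine hline.continuous.continuousAt.preimage_mem_nhds (Φ.open_target.mem_nhds ?_)
      exact hline0 ▸ Φ.map_source hpΦ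
    obtain ⟨ε, hε, hball⟩ := Metric.mem_nhds_iff.1 htarget
    rw [Real.ball_eq_Ioo, zero_sub, zero_add] at hball
    refine ⟨Φ.symm ∘ line, ε, hε, hsymm.comp hline.contDiffOn hball, fun t ht => ?_, ?_, ?_⟩
    · change g (Φ.symm (line t)) = 0
      rw [hzero, Φ.right_inv (hball ht)]
      exact Submodule.add_mem _ ((hzero p).1 hp) (Submodule.smul_mem _ t hu)
    · rw [Function.comp_apply, hline0, Φ.left_inv hpΦ]
    · have hsymm' : HasFDerivAt Φ.symm (ContinuousLinearEquiv.refl ℝ E).symm.toContinuousLinearMap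
          (line 0) := by
        rw [hline0]
        exact Φ.hasFDerivAt_symm (Φ.map_source hpΦ) (by rwa [Φ.left_inv hpΦ])
      exact hsymm'.comp_hasDerivAt 0 hline'

end

theorem normalSpace_zeroSet [InnerProductSpace ℝ F] [FiniteDimensional ℝ F]
    {g : E → F} {p : E} (hg : ContDiff ℝ ∞ g) (hp : g p = 0)
    (hreg : Function.Surjective (fderiv ℝ g p)) :
    normalSpace {q | g q = 0} p = (fderiv ℝ g p)†.range := by
  have htangent : {u | IsTangentVector {q | g q = 0} p u} = (fderiv ℝ g p).ker :=
    Set.ext fun u => isTangentVector_zeroSet_iff hg hp hreg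
  rw [normalSpace, htangent, Submodule.span_eq, orthogonal_ker_eq_range_adjoint]

end Submanifold

section HessianBound

variable {E F : Type*} [NormedAddCommGroup E] [NormedSpace ℝ E]
  [NormedAddCommGroup F] [NormedSpace ℝ F] {g : E → F}

/-- The supremum of `‖D²g‖` over the closed unit ball around `p`. It bounds both the second
derivative of `g` at `p` and the remainder of the linear approximation of `g` near `p`. -/
def hessianBound (g : E → F) (p : E) : ℝ :=
  sSup ((fun w => ‖fderiv ℝ (fderiv ℝ g) (p + w)‖) '' Metric.closedBall 0 1)

theorem hessianBound_nonneg (g : E → F) (p : E) : 0 ≤ hessianBound g p :=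
  Real.sSup_nonneg fun _ ⟨_, _, hw⟩ => hw ▸ norm_nonneg (fderiv ℝ (fderiv ℝ g) _)

theorem continuous_norm_fderiv_fderiv (hg : ContDiff ℝ 2 g) :
    Continuous fun q => ‖fderiv ℝ (fderiv ℝ g) q‖ :=
  continuous_norm.comp ((hg.fderiv_right (m := 1) (by norm_num)).continuous_fderiv (by simp))

variable [ProperSpace E]

theorem continuous_hessianBound (hg : ContDiff ℝ 2 g) : Continuous (hessianBound g) :=
  (isCompact_closedBall 0 1).continuous_sSup
    ((continuous_norm_fderiv_fderiv hg).comp (continuous_fst.add continuous_snd))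

theorem norm_fderiv_fderiv_le_hessianBound (hg : ContDiff ℝ 2 g) {p q : E}
    (hq : q ∈ Metric.closedBall p 1) : ‖fderiv ℝ (fderiv ℝ g) q‖ ≤ hessianBound g p := by
  have hshift : Continuous fun w => ‖fderiv ℝ (fderiv ℝ g) (p + w)‖ :=
    (continuous_norm_fderiv_fderiv hg).comp (continuous_const_add p)
  refine le_csSup ((isCompact_closedBall 0 1).image hshift).bddAbove ⟨q - p, ?_, ?_⟩
  · simpa [dist_eq_norm] using hq
  · simp

theorem norm_sub_sub_fderiv_le_hessianBound (hg : ContDiff ℝ 2 g) {p q : E} (hq : ‖q - p‖ ≤ 1) :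
    ‖g q - g p - fderiv ℝ g p (q - p)‖ ≤ hessianBound g p * ‖q - p‖ ^ 2 := by
  have hball : Metric.closedBall p ‖q - p‖ ⊆ Metric.closedBall p 1 :=
    Metric.closedBall_subset_closedBall hq
  have hpmem : p ∈ Metric.closedBall p ‖q - p‖ := Metric.mem_closedBall_self (norm_nonneg _)
  have hqmem : q ∈ Metric.closedBall p ‖q - p‖ := by simp [dist_eq_norm]
  have hgrad (y : E) (hy : y ∈ Metric.closedBall p ‖q - p‖) :
      ‖fderiv ℝ g y - fderiv ℝ g p‖ ≤ hessianBound g p * ‖q - p‖ := by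
    have hdiff : Differentiable ℝ (fderiv ℝ g) :=
      (hg.fderiv_right (m := 1) (by norm_num)).differentiable (by simp)
    calc ‖fderiv ℝ g y - fderiv ℝ g p‖ ≤ hessianBound g p * ‖y - p‖ :=
          (convex_closedBall p _).norm_image_sub_le_of_norm_fderiv_le (fun x _ => hdiff x)
            (fun x hx => norm_fderiv_fderiv_le_hessianBound hg (hball hx)) hpmem hy
      _ ≤ hessianBound g p * ‖q - p‖ := by
          gcongr
          · exact hessianBound_nonneg g p
          · rwa [← dist_eq_norm]
  calc ‖g q - g p - fderiv ℝ g p (q - p)‖ ≤ hessianBound g p * ‖q - p‖ * ‖q - p‖ :=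
        (convex_closedBall p _).norm_image_sub_le_of_norm_fderiv_le'
          (fun x _ => hg.differentiable (by simp) x) hgrad hpmem hqmem
    _ = hessianBound g p * ‖q - p‖ ^ 2 := by ring

end HessianBound

section LagrangeMap

variable {E F : Type*} [NormedAddCommGroup E] [InnerProductSpace ℝ E] [CompleteSpace E]
  [NormedAddCommGroup F] [InnerProductSpace ℝ F] [CompleteSpace F] {g : E → F}

/-- The adjoint as a linear map of real operator spaces, so that it can be differentiated:
`ContinuousLinearMap.adjoint` is only conjugate-linear, and over `ℝ` its type does not reduce to
that of a linear map. -/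
def adjointCLM : (E →L[ℝ] F) →L[ℝ] (F →L[ℝ] E) where
  toFun A := A†
  map_add' := map_add _
  map_smul' a A := by simp
  cont := ContinuousLinearMap.adjoint.continuous

/-- The Lagrange map `(y, lam) ↦ (y - (D g y)† lam, g y)` of the constraint `g = 0`. It takes the
value `(c, 0)` exactly at the solutions of the Lagrange system of `min ‖y - c‖² / 2` subject to
`g y = 0`. -/
def lagrangeMap (g : E → F) (z : E × F) : E × F :=
  (z.1 - ((fderiv ℝ g z.1)†) z.2, g z.1)

theorem contDiff_lagrangeMap (hg : ContDiff ℝ ∞ g) : ContDiff ℝ ∞ (lagrangeMap g) := by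
  have hgrad : ContDiff ℝ ∞ fun z : E × F => adjointCLM (fderiv ℝ g z.1) z.2 :=
    (adjointCLM.contDiff.comp ((hg.fderiv_right (by simp)).comp contDiff_fst)).clm_apply
      contDiff_snd
  exact (contDiff_fst.sub hgrad).prodMk (hg.comp contDiff_fst)

theorem fderiv_lagrangeMap_apply (hg : ContDiff ℝ 2 g) (p u : E) (lam mu : F) :
    fderiv ℝ (lagrangeMap g) (p, lam) (u, mu) =
      (u - (((fderiv ℝ (fderiv ℝ g) p u)†) lam + ((fderiv ℝ g p)†) mu), fderiv ℝ g p u) := by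
  have hfst : HasFDerivAt Prod.fst (.fst ℝ E F) (p, lam) := hasFDerivAt_fst
  have hg' : HasFDerivAt g (fderiv ℝ g p) p := (hg.differentiable (by simp) p).hasFDerivAt
  have hg'' : HasFDerivAt (fderiv ℝ g) (fderiv ℝ (fderiv ℝ g) p) p :=
    ((hg.fderiv_right (m := 1) (by norm_num)).differentiable (by simp) p).hasFDerivAt
  have hadj : HasFDerivAt (fun z : E × F => adjointCLM (fderiv ℝ g z.1))
      (adjointCLM ∘L (fderiv ℝ (fderiv ℝ g) p ∘L .fst ℝ E F)) (p, lam) :=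
    (adjointCLM (E := E) (F := F)).hasFDerivAt.comp (p, lam) (hg''.comp (p, lam) hfst)
  have hlagrange : HasFDerivAt (lagrangeMap g) _ (p, lam) :=
    (hfst.sub (hadj.clm_apply hasFDerivAt_snd)).prodMk (hg'.comp (p, lam) hfst)
  rw [hlagrange.fderiv]
  simp [adjointCLM, add_comm]

end LagrangeMap

section ClosestPoint

variable {E F : Type*} [NormedAddCommGroup E] [InnerProductSpace ℝ E] [FiniteDimensional ℝ E]
  [NormedAddCommGroup F] [InnerProductSpace ℝ F] [CompleteSpace F] {g : E → F} {p q : E} {lam : F}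

theorem injective_fderiv_lagrangeMap (hg : ContDiff ℝ 2 g)
    (hp : Function.Injective ((fderiv ℝ g p)†)) (hlam : ‖lam‖ * hessianBound g p < 1) :
    Function.Injective (fderiv ℝ (lagrangeMap g) (p, lam)) := by
  rw [injective_iff_map_eq_zero]
  rintro ⟨u, mu⟩ hu
  rw [fderiv_lagrangeMap_apply hg, Prod.mk_eq_zero, sub_eq_zero] at hu
  obtain ⟨hstat, htan⟩ := hu
  have hnorm : ‖u‖ ^ 2 = inner ℝ (fderiv ℝ (fderiv ℝ g) p u u) lam := by
    calc ‖u‖ ^ 2 = inner ℝ u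
          (((fderiv ℝ (fderiv ℝ g) p u)†) lam + ((fderiv ℝ g p)†) mu) := by
          rw [← hstat, real_inner_self_eq_norm_sq]
      _ = inner ℝ (fderiv ℝ (fderiv ℝ g) p u u) lam := by
          rw [inner_add_right, ContinuousLinearMap.adjoint_inner_right,
            ContinuousLinearMap.adjoint_inner_right, htan, inner_zero_left, add_zero]
  have hbound : ‖u‖ ^ 2 ≤ ‖lam‖ * hessianBound g p * ‖u‖ ^ 2 := by
    calc ‖u‖ ^ 2 ≤ ‖fderiv ℝ (fderiv ℝ g) p u u‖ * ‖lam‖ := hnorm ▸ real_inner_le_norm _ _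
      _ ≤ ‖fderiv ℝ (fderiv ℝ g) p‖ * ‖u‖ * ‖u‖ * ‖lam‖ := by
        gcongr
        exact (fderiv ℝ (fderiv ℝ g) p).le_opNorm₂ u u
      _ ≤ hessianBound g p * ‖u‖ * ‖u‖ * ‖lam‖ := by
        gcongr
        exact norm_fderiv_fderiv_le_hessianBound hg (Metric.mem_closedBall_self zero_le_one)
      _ = ‖lam‖ * hessianBound g p * ‖u‖ ^ 2 := by ring
  have hu0 : u = 0 := by
    by_contra hne
    have hpos : 0 < ‖u‖ ^ 2 := by positivity
    nlinarith
  subst hu0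
  rw [map_zero, map_zero, zero_apply, zero_add, eq_comm] at hstat
  rw [(injective_iff_map_eq_zero _).1 hp mu hstat, Prod.mk_zero_zero]

theorem abs_inner_adjoint_fderiv_lt (hg : ContDiff ℝ 2 g) (hp : g p = 0)
    (hq : g q = 0) (hqp : q ≠ p) (hlam : ‖lam‖ * hessianBound g p < 1 / 2)
    (hgrad : ‖((fderiv ℝ g p)†) lam‖ < 1 / 2) :
    |inner ℝ (q - p) (((fderiv ℝ g p)†) lam)| < ‖q - p‖ ^ 2 / 2 := by
  have hpos : 0 < ‖q - p‖ := norm_pos_iff.2 (sub_ne_zero.2 hqp)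
  rcases le_total ‖q - p‖ 1 with hnear | hfar
  · have htaylor := norm_sub_sub_fderiv_le_hessianBound hg hnear
    rw [hp, hq, sub_self, zero_sub, norm_neg] at htaylor
    calc |inner ℝ (q - p) (((fderiv ℝ g p)†) lam)|
        ≤ ‖fderiv ℝ g p (q - p)‖ * ‖lam‖ := by
          rw [ContinuousLinearMap.adjoint_inner_right]
          exact abs_real_inner_le_norm _ _
      _ ≤ hessianBound g p * ‖q - p‖ ^ 2 * ‖lam‖ := by gcongr
      _ = ‖lam‖ * hessianBound g p * ‖q - p‖ ^ 2 := by ring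
      _ < 1 / 2 * ‖q - p‖ ^ 2 := by gcongr
      _ = ‖q - p‖ ^ 2 / 2 := by ring
  · calc |inner ℝ (q - p) (((fderiv ℝ g p)†) lam)|
        ≤ ‖q - p‖ * ‖((fderiv ℝ g p)†) lam‖ := abs_real_inner_le_norm _ _
      _ < ‖q - p‖ * (1 / 2) := by gcongr
      _ ≤ ‖q - p‖ ^ 2 / 2 := by nlinarith

theorem dist_sub_adjoint_fderiv_lt (hg : ContDiff ℝ 2 g) (hp : g p = 0)
    (hq : g q = 0) (hqp : q ≠ p) (hlam : ‖lam‖ * hessianBound g p < 1 / 2)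
    (hgrad : ‖((fderiv ℝ g p)†) lam‖ < 1 / 2) :
    dist (p - ((fderiv ℝ g p)†) lam) p < dist (p - ((fderiv ℝ g p)†) lam) q := by
  set v := ((fderiv ℝ g p)†) lam
  have hinner := (abs_lt.1 (abs_inner_adjoint_fderiv_lt hg hp hq hqp hlam hgrad)).1
  have hexpand : ‖q - p + v‖ ^ 2 = ‖q - p‖ ^ 2 + 2 * inner ℝ (q - p) v + ‖v‖ ^ 2 :=
    norm_add_sq_real _ _
  rw [dist_comm, dist_comm _ q, dist_eq_norm, dist_eq_norm, sub_sub_cancel, ← sub_add]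
  exact lt_of_pow_lt_pow_left₀ 2 (norm_nonneg _) (by linarith)

end ClosestPoint

section Tube

variable {E : Type*} [NormedAddCommGroup E] [InnerProductSpace ℝ E] {M : Set E} {δ : E → ℝ}

theorem injOn_add_normalTube (hclosest : ∀ q ∈ normalTube M δ, ∀ p ∈ M, p ≠ q.1 →
      dist (q.1 + q.2) q.1 < dist (q.1 + q.2) p) :
    Set.InjOn (fun q : E × E => q.1 + q.2) (normalTube M δ) := by
  intro q hq r hr (hqr : q.1 + q.2 = r.1 + r.2)
  have hfst : q.1 = r.1 := by
    by_contra hne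
    exact lt_asymm (hqr ▸ hclosest q hq r.1 hr.1.1 (Ne.symm hne)) (hclosest r hr q.1 hq.1.1 hne)
  exact Prod.ext hfst (add_left_cancel (hfst ▸ hqr))

theorem eventually_mem_normalTube {P : E → E} {q : E × E} (hδ : ContinuousOn δ M)
    (hq : q ∈ normalTube M δ) (hP : ContinuousAt P (q.1 + q.2)) (hPq : P (q.1 + q.2) = q.1)
    (hnormal : ∀ᶠ c in 𝓝 (q.1 + q.2), (P c, c - P c) ∈ normalBundle M) :
    ∀ᶠ c in 𝓝 (q.1 + q.2), (P c, c - P c) ∈ normalTube M δ := by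
  have hPM : Filter.Tendsto P (𝓝 (q.1 + q.2)) (𝓝[M] q.1) :=
    tendsto_nhdsWithin_iff.2 ⟨by rwa [ContinuousAt, hPq] at hP, hnormal.mono fun c hc => hc.1⟩
  have hdist : Filter.Tendsto (fun c => ‖c - P c‖) (𝓝 (q.1 + q.2)) (𝓝 ‖q.2‖) := by
    have := (continuousAt_id.sub hP).norm.tendsto
    rwa [Pi.sub_apply, id_eq, hPq, add_sub_cancel_left] at this
  exact hnormal.and (hdist.eventually_lt ((hδ q.1 hq.1.1).tendsto.comp hPM) hq.2)

theorem isTubularNeighborhood_image (hδ : ContinuousOn δ M) (hpos : ∀ p ∈ M, 0 < δ p)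
    (hinj : Set.InjOn (fun q : E × E => q.1 + q.2) (normalTube M δ))
    (hsection : ∀ q ∈ normalTube M δ, ∃ P : E → E,
      ContDiffAt ℝ ∞ P (q.1 + q.2) ∧ P (q.1 + q.2) = q.1 ∧
        ∀ᶠ c in 𝓝 (q.1 + q.2), (P c, c - P c) ∈ normalBundle M) :
    IsTubularNeighborhood M ((fun q : E × E => q.1 + q.2) '' normalTube M δ) := by
  set T := normalTube M δ
  set endpoint : E × E → E := fun q => q.1 + q.2
  have hlocal (q) (hq : q ∈ T) :
      ∃ P : E → E, ContDiffAt ℝ ∞ P (endpoint q) ∧ ∀ᶠ c in 𝓝 (endpoint q), (P c, c - P c) ∈ T := by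
    obtain ⟨P, hP, hPq, hnormal⟩ := hsection q hq
    exact ⟨P, hP, eventually_mem_normalTube hδ hq hP.continuousAt hPq hnormal⟩
  refine ⟨?_, ?_, δ, hδ, hpos, hinj.bijOn_image, Function.invFunOn endpoint T, ?_,
    hinj.leftInvOn_invFunOn, fun c hc => Function.invFunOn_eq hc⟩
  · rw [isOpen_iff_mem_nhds]
    rintro _ ⟨q, hq, rfl⟩
    obtain ⟨P, -, hP⟩ := hlocal q hq
    filter_upwards [hP] with c hc using ⟨_, hc, add_sub_cancel _ _⟩
  · exact fun p hp => ⟨(p, 0), ⟨⟨hp, zero_mem _⟩, by simpa using hpos p hp⟩, add_zero p⟩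
  · rintro _ ⟨q, hq, rfl⟩
    obtain ⟨P, hPsmooth, hP⟩ := hlocal q hq
    refine ((hPsmooth.prodMk (contDiffAt_id.sub hPsmooth)).congr_of_eventuallyEq
      ?_).contDiffWithinAt
    filter_upwards [hP] with c hc
    have hadd : endpoint (P c, c - P c) = c := add_sub_cancel _ _
    have hcT : c ∈ endpoint '' T := ⟨_, hc, hadd⟩
    exact hinj (Function.invFunOn_mem hcT) hc ((Function.invFunOn_eq hcT).trans hadd.symm)

end Tube

section RegularZeroSet

variable {E F : Type*} [NormedAddCommGroup E] [InnerProductSpace ℝ E] [FiniteDimensional ℝ E]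
  [NormedAddCommGroup F] [InnerProductSpace ℝ F] [FiniteDimensional ℝ F] {g : E → F}

theorem exists_local_footPoint {p : E} {lam : F} (hg : ContDiff ℝ ∞ g)
    (hreg : ∀ p, g p = 0 → Function.Surjective (fderiv ℝ g p))
    (hp : g p = 0) (hinj : Function.Injective (fderiv ℝ (lagrangeMap g) (p, lam))) :
    ∃ P : E → E, ContDiffAt ℝ ∞ P (p - ((fderiv ℝ g p)†) lam) ∧ P (p - ((fderiv ℝ g p)†) lam) = p ∧
      ∀ᶠ c in 𝓝 (p - ((fderiv ℝ g p)†) lam), (P c, c - P c) ∈ normalBundle {q | g q = 0} := by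
  obtain ⟨Φ, hsource, hΦ, hsymm⟩ := exists_openPartialHomeomorph_contDiffOn_symm
    (contDiff_lagrangeMap hg) (isInvertible_of_injective hinj)
  set c₀ := p - ((fderiv ℝ g p)†) lam
  have hΦp : Φ (p, lam) = (c₀, 0) := by rw [hΦ, lagrangeMap, hp]
  have htarget : Φ.target ∈ 𝓝 (c₀, (0 : F)) :=
    Φ.open_target.mem_nhds (hΦp ▸ Φ.map_source hsource)
  have hslice : ContDiffAt ℝ ∞ (fun c : E => (c, (0 : F))) c₀ :=
    contDiffAt_id.prodMk contDiffAt_const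
  refine ⟨fun c => (Φ.symm (c, 0)).1, ?_, ?_, ?_⟩
  · exact ((hsymm.contDiffAt htarget).comp c₀ hslice).fst
  · exact congrArg Prod.fst (hΦp ▸ Φ.left_inv hsource)
  · filter_upwards [hslice.continuousAt.preimage_mem_nhds htarget] with c hc
    have hsol : lagrangeMap g (Φ.symm (c, 0)) = (c, 0) := hΦ ▸ Φ.right_inv hc
    obtain ⟨hstat, hzero⟩ := Prod.mk.inj hsol
    refine ⟨hzero, ?_⟩
    rw [normalSpace_zeroSet hg hzero (hreg _ hzero)]
    refine ⟨-(Φ.symm (c, 0)).2, ?_⟩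
    rw [ContinuousLinearMap.coe_coe, map_neg]
    exact eq_sub_of_add_eq' (by rw [← sub_eq_add_neg, hstat])

/-- The radius of the tube around the zero set of `g` at `p`. A normal vector of `{g = 0}` at `p`
that is shorter than this is at most `1 / 2` in norm, and the product of its multiplier with
`hessianBound g p` is less than `1 / 2`. -/
def tubeRadius (g : E → F) (p : E) : ℝ :=
  1 / (2 * (‖penroseRightInverse (fderiv ℝ g p)‖ * hessianBound g p + 1))

theorem tubeRadius_pos (g : E → F) (p : E) : 0 < tubeRadius g p := by
  have := hessianBound_nonneg g p
  unfold tubeRadius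
  positivity

theorem continuousOn_tubeRadius (hg : ContDiff ℝ 2 g)
    (hreg : ∀ p, g p = 0 → Function.Surjective (fderiv ℝ g p)) :
    ContinuousOn (tubeRadius g) {q | g q = 0} := by
  intro p hp
  have hpenrose : ContinuousAt (fun q => penroseRightInverse (fderiv ℝ g q)) p :=
    (continuousAt_penroseRightInverse (hreg p hp)).comp
      (hg.continuous_fderiv (by simp)).continuousAt
  have hden : 2 * (‖penroseRightInverse (fderiv ℝ g p)‖ * hessianBound g p + 1) ≠ 0 :=
    (one_div_pos.1 (tubeRadius_pos g p)).ne'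
  exact (continuousAt_const.div (continuousAt_const.mul ((hpenrose.norm.mul
    (continuous_hessianBound hg).continuousAt).add continuousAt_const)) hden).continuousWithinAt

theorem exists_multiplier_of_mem_normalTube (hg : ContDiff ℝ ∞ g)
    (hreg : ∀ p, g p = 0 → Function.Surjective (fderiv ℝ g p)) {q : E × E}
    (hq : q ∈ normalTube {q | g q = 0} (tubeRadius g)) :
    ∃ lam : F, q.1 + q.2 = q.1 - ((fderiv ℝ g q.1)†) lam ∧
      ‖lam‖ * hessianBound g q.1 < 1 / 2 ∧ ‖((fderiv ℝ g q.1)†) lam‖ < 1 / 2 := by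
  obtain ⟨⟨hzero : g q.1 = 0, hnormal⟩, hlt⟩ := hq
  rw [normalSpace_zeroSet hg hzero (hreg _ hzero)] at hnormal
  obtain ⟨mu, hmu : ((fderiv ℝ g q.1)†) mu = q.2⟩ := hnormal
  set C := hessianBound g q.1
  set N := ‖penroseRightInverse (fderiv ℝ g q.1)‖
  have hC : 0 ≤ C := hessianBound_nonneg g q.1
  have hNC : 0 ≤ N * C := by positivity
  have hradius : ‖q.2‖ * (2 * (N * C + 1)) < 1 := (lt_div_iff₀ (by positivity)).1 hlt
  refine ⟨-mu, by rw [map_neg, sub_neg_eq_add, hmu], ?_, ?_⟩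
  · have hmul : ‖mu‖ ≤ N * ‖q.2‖ :=
      hmu ▸ norm_le_penroseRightInverse_mul_norm_adjoint (hreg _ hzero) mu
    calc ‖-mu‖ * C ≤ N * ‖q.2‖ * C := by rw [norm_neg]; gcongr
      _ < 1 / 2 := by nlinarith [norm_nonneg q.2]
  · rw [map_neg, norm_neg, hmu]
    nlinarith [norm_nonneg q.2]

theorem dist_add_lt_of_mem_normalTube (hg : ContDiff ℝ ∞ g)
    (hreg : ∀ p, g p = 0 → Function.Surjective (fderiv ℝ g p)) {q : E × E}
    (hq : q ∈ normalTube {q | g q = 0} (tubeRadius g)) {p : E} (hp : g p = 0) (hne : p ≠ q.1) :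
    dist (q.1 + q.2) q.1 < dist (q.1 + q.2) p := by
  obtain ⟨lam, hq2, hlam, hgrad⟩ := exists_multiplier_of_mem_normalTube hg hreg hq
  rw [hq2]
  exact dist_sub_adjoint_fderiv_lt (contDiff_infty.1 hg 2) hq.1.1 hp hne hlam hgrad

theorem exists_injective_fderiv_lagrangeMap_of_mem_normalTube (hg : ContDiff ℝ ∞ g)
    (hreg : ∀ p, g p = 0 → Function.Surjective (fderiv ℝ g p)) {q : E × E}
    (hq : q ∈ normalTube {q | g q = 0} (tubeRadius g)) :
    ∃ lam : F, q.1 + q.2 = q.1 - ((fderiv ℝ g q.1)†) lam ∧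
      Function.Injective (fderiv ℝ (lagrangeMap g) (q.1, lam)) := by
  obtain ⟨lam, hq2, hlam, -⟩ := exists_multiplier_of_mem_normalTube hg hreg hq
  exact ⟨lam, hq2, injective_fderiv_lagrangeMap (contDiff_infty.1 hg 2)
    (injective_adjoint_iff_surjective.2 (hreg _ hq.1.1)) (by linarith)⟩

theorem isTubularNeighborhood_zeroSet (hg : ContDiff ℝ ∞ g)
    (hreg : ∀ p, g p = 0 → Function.Surjective (fderiv ℝ g p)) :
    IsTubularNeighborhood {q | g q = 0}
      ((fun q : E × E => q.1 + q.2) '' normalTube {q | g q = 0} (tubeRadius g)) := by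
  refine isTubularNeighborhood_image
    (continuousOn_tubeRadius (contDiff_infty.1 hg 2) hreg) (fun p _ => tubeRadius_pos g p)
    (injOn_add_normalTube fun q hq p hp => dist_add_lt_of_mem_normalTube hg hreg hq hp)
    fun q hq => ?_
  obtain ⟨lam, hq2, hinj⟩ := exists_injective_fderiv_lagrangeMap_of_mem_normalTube hg hreg hq
  exact hq2 ▸ exists_local_footPoint hg hreg hq.1.1 hinj

theorem isClosestPoint_of_mem_normalTube (hg : ContDiff ℝ ∞ g)
    (hreg : ∀ p, g p = 0 → Function.Surjective (fderiv ℝ g p)) {q : E × E}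
    (hq : q ∈ normalTube {q | g q = 0} (tubeRadius g)) :
    IsClosestPoint {q | g q = 0} (q.1 + q.2) q.1 ∧
      ∀ p, IsClosestPoint {q | g q = 0} (q.1 + q.2) p → p = q.1 := by
  refine ⟨⟨hq.1.1, fun p hp => ?_⟩, fun p hp => ?_⟩
  · rcases eq_or_ne p q.1 with rfl | hne
    · rfl
    · exact (dist_add_lt_of_mem_normalTube hg hreg hq hp hne).le
  · by_contra hne
    exact (dist_add_lt_of_mem_normalTube hg hreg hq hp.1 hne).not_ge (hp.2 _ hq.1.1)

end RegularZeroSet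

section PolynomialSystem

open MvPolynomial

variable {R σ ι : Type*} [CommRing R]

/-- The map `y ↦ (F i (y))_i` given by a polynomial system `F` at points `y` with coordinates in
an algebra `𝕜` over the coefficient ring. -/
def evalSystem (𝕜 : Type*) [CommRing 𝕜] [Algebra R 𝕜] (F : ι → MvPolynomial σ R) (y : σ → 𝕜) :
    ι → 𝕜 :=
  fun i => aeval y (F i)

/-- The matrix `(∂F_i / ∂y_s)` of a polynomial system `F` at a point with coordinates in an
algebra `𝕜` over the coefficient ring. -/
def jacobianMatrix (𝕜 : Type*) [CommRing 𝕜] [Algebra R 𝕜] (F : ι → MvPolynomial σ R)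
    (y : σ → 𝕜) : Matrix ι σ 𝕜 :=
  Matrix.of fun i s => aeval y (pderiv s (F i))

theorem isZeroOf_iff_evalSystem_eq_zero {𝕜 : Type*} [CommRing 𝕜] [Algebra ℝ 𝕜]
    {F : ι → MvPolynomial σ ℝ} {y : σ → 𝕜} : IsZeroOf 𝕜 F y ↔ evalSystem 𝕜 F y = 0 :=
  funext_iff.symm

theorem jacobianMatrix_algebraMap {𝕜 A : Type*} [CommRing 𝕜] [CommRing A] [Algebra R 𝕜]
    [Algebra R A] [Algebra 𝕜 A] [IsScalarTower R 𝕜 A] (F : ι → MvPolynomial σ R) (y : σ → 𝕜) :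
    jacobianMatrix A F (fun s => algebraMap 𝕜 A (y s)) =
      (jacobianMatrix 𝕜 F y).map (algebraMap 𝕜 A) :=
  Matrix.ext fun i s => aeval_algebraMap_apply A y (pderiv s (F i))

variable [Fintype σ] {𝕜 : Type*} [NontriviallyNormedField 𝕜] [Algebra R 𝕜]

theorem hasFDerivAt_aeval (P : MvPolynomial σ R) (y : σ → 𝕜) :
    HasFDerivAt (fun x : σ → 𝕜 => aeval x P)
      (∑ s, aeval y (pderiv s P) • (ContinuousLinearMap.proj s : (σ → 𝕜) →L[𝕜] 𝕜)) y := by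
  classical
  induction P using MvPolynomial.induction_on with
  | C a =>
    simp only [aeval_C]
    refine (hasFDerivAt_const (𝕜 := 𝕜) (algebraMap R 𝕜 a) y).congr_fderiv ?_
    ext u
    simp
  | add P Q hP hQ =>
    simp only [map_add]
    refine (hP.fun_add hQ).congr_fderiv ?_
    rw [← Finset.sum_add_distrib]
    exact Finset.sum_congr rfl fun s _ => (add_smul _ _ _).symm
  | mul_X P t hP =>
    simp only [map_mul, aeval_X]
    refine (hP.mul (hasFDerivAt_apply (𝕜 := 𝕜) t y)).congr_fderiv ?_
    ext u
    simp [pderiv_X, Pi.single_apply, Finset.sum_add_distrib, add_mul, Finset.mul_sum, mul_assoc,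
      apply_ite]

theorem hasFDerivAt_evalSystem [Finite ι] [CompleteSpace 𝕜] (F : ι → MvPolynomial σ R)
    (y : σ → 𝕜) :
    HasFDerivAt (evalSystem 𝕜 F) (jacobianMatrix 𝕜 F y).mulVecLin.toContinuousLinearMap y := by
  have := Fintype.ofFinite ι
  refine hasFDerivAt_pi'.2 fun i => (hasFDerivAt_aeval (F i) y).congr_fderiv ?_
  ext u
  simp [jacobianMatrix, Matrix.mulVec, dotProduct]

theorem contDiff_evalSystem [Fintype ι] [CompleteSpace 𝕜] (F : ι → MvPolynomial σ R)
    {m : WithTop ℕ∞} : ContDiff 𝕜 m (evalSystem 𝕜 F) :=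
  contDiff_pi.2 fun i => contDiff_iff_contDiffAt.2 fun y =>
    (AnalyticAt.aeval_mvPolynomial
      (fun s => (ContinuousLinearMap.proj s : (σ → 𝕜) →L[𝕜] 𝕜).analyticAt y) (F i)).contDiffAt

theorem injective_fderiv_evalSystem_iff [CompleteSpace 𝕜] [DecidableEq σ]
    {F : σ → MvPolynomial σ R} {y : σ → 𝕜} :
    Function.Injective (fderiv 𝕜 (evalSystem 𝕜 F) y) ↔ (jacobianMatrix 𝕜 F y).det ≠ 0 := by
  rw [(hasFDerivAt_evalSystem F y).fderiv, ← isUnit_iff_ne_zero, ← Matrix.isUnit_iff_isUnit_det,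
    ← Matrix.mulVec_injective_iff_isUnit]
  rfl

theorem isSimpleZero_iff [DecidableEq σ] {F : σ → MvPolynomial σ ℝ} {z : σ → ℝ} :
    IsSimpleZero F z ↔ IsZeroOf ℝ F z ∧ Function.Injective (fderiv ℝ (evalSystem ℝ F) z) := by
  rw [injective_fderiv_evalSystem_iff]
  rfl

theorem IsSimpleZero.isIsolatedZero [DecidableEq σ] {F : σ → MvPolynomial σ ℝ} {z : σ → ℝ}
    (hz : IsSimpleZero F z) : IsIsolatedZero F z := by
  refine ⟨hz.1, ?_⟩
  have hinj : Function.Injective (fderiv ℂ (evalSystem ℂ F) fun s => (z s : ℂ)) := by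
    rw [injective_fderiv_evalSystem_iff]
    have hdet := injective_fderiv_evalSystem_iff.1 (isSimpleZero_iff.1 hz).2
    have hcomplex : jacobianMatrix ℂ F (fun s => (z s : ℂ)) =
        (algebraMap ℝ ℂ).mapMatrix (jacobianMatrix ℝ F z) := jacobianMatrix_algebraMap F z
    rw [hcomplex, ← RingHom.map_det]
    exact (map_ne_zero _).2 hdet
  obtain ⟨K, -, hK⟩ := (LinearMap.injective_iff_antilipschitz
    (fderiv ℂ (evalSystem ℂ F) fun s => (z s : ℂ)).toLinearMap).1 hinj
  have hne := ((hasFDerivAt_evalSystem (𝕜 := ℂ) F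
    fun s => (z s : ℂ)).differentiableAt.hasFDerivAt).eventually_ne (c := 0) ⟨K, hK⟩
  filter_upwards [eventually_nhdsWithin_iff.1 hne] with y hy hy0
  by_contra hyz
  exact hy hyz (isZeroOf_iff_evalSystem_eq_zero.1 hy0)

end PolynomialSystem

section PolynomialMap

variable {σ ι : Type*}

/-- The map between Euclidean spaces given by a real polynomial system. -/
def polynomialMap (h : ι → MvPolynomial σ ℝ) (p : EuclideanSpace ℝ σ) : EuclideanSpace ℝ ι :=
  WithLp.toLp 2 (evalSystem ℝ h p)

theorem realZeroSet_eq (h : ι → MvPolynomial σ ℝ) :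
    realZeroSet h = {p | polynomialMap h p = 0} :=
  Set.ext fun _ => isZeroOf_iff_evalSystem_eq_zero.trans (WithLp.toLp_eq_zero 2).symm

theorem contDiff_polynomialMap [Fintype σ] [Fintype ι] (h : ι → MvPolynomial σ ℝ) {m : WithTop ℕ∞} :
    ContDiff ℝ m (polynomialMap h) :=
  (EuclideanSpace.equiv ι ℝ).symm.contDiff.comp
    ((contDiff_evalSystem h).comp (EuclideanSpace.equiv σ ℝ).contDiff)

theorem fderiv_polynomialMap_apply [Fintype σ] [Finite ι] (h : ι → MvPolynomial σ ℝ)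
    (p u : EuclideanSpace ℝ σ) :
    fderiv ℝ (polynomialMap h) p u = WithLp.toLp 2 ((jacobianMatrix ℝ h p).mulVec u) := by
  have := Fintype.ofFinite ι
  have hderiv : HasFDerivAt (polynomialMap h) _ p :=
    (EuclideanSpace.equiv ι ℝ).symm.hasFDerivAt.comp p
      ((hasFDerivAt_evalSystem h p).comp p (EuclideanSpace.equiv σ ℝ).hasFDerivAt)
  rw [hderiv.fderiv]
  rfl

theorem adjoint_fderiv_polynomialMap_apply [Fintype σ] [Fintype ι] (h : ι → MvPolynomial σ ℝ)
    (p : EuclideanSpace ℝ σ) (lam : EuclideanSpace ℝ ι) :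
    ((fderiv ℝ (polynomialMap h) p)†) lam =
      WithLp.toLp 2 (Matrix.vecMul lam (jacobianMatrix ℝ h p)) := by
  refine ext_inner_right ℝ fun u => ?_
  rw [ContinuousLinearMap.adjoint_inner_left, fderiv_polynomialMap_apply,
    EuclideanSpace.inner_eq_star_dotProduct, EuclideanSpace.inner_eq_star_dotProduct, star_trivial,
    star_trivial, dotProduct_comm, Matrix.dotProduct_mulVec, dotProduct_comm]

theorem surjective_fderiv_polynomialMap [Finite σ] [Finite ι] {h : ι → MvPolynomial σ ℝ}
    {p : EuclideanSpace ℝ σ} (hp : LinearIndependent ℝ (jacobianMatrix ℝ h p).row) :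
    Function.Surjective (fderiv ℝ (polynomialMap h) p) := by
  have := Fintype.ofFinite σ
  have := Fintype.ofFinite ι
  rw [← injective_adjoint_iff_surjective]
  intro lam mu heq
  rw [adjoint_fderiv_polynomialMap_apply, adjoint_fderiv_polynomialMap_apply] at heq
  exact WithLp.ofLp_injective 2
    (Matrix.vecMul_injective_iff.2 hp (WithLp.toLp_injective 2 heq))

end PolynomialMap

section LagrangeSystem

variable {σ ι : Type*} [Fintype σ] [Fintype ι] {h : ι → MvPolynomial σ ℝ}
  {c p : EuclideanSpace ℝ σ} {lam mu : EuclideanSpace ℝ ι}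

/-- The unknowns of the Lagrange system as one coordinate vector: `(y, lam) ↦ Sum.elim y lam`. -/
def lagrangeCoords (σ ι : Type*) [Fintype σ] [Fintype ι] :
    (EuclideanSpace ℝ σ × EuclideanSpace ℝ ι) ≃L[ℝ] (σ ⊕ ι → ℝ) :=
  ((EuclideanSpace.equiv σ ℝ).prodCongr (EuclideanSpace.equiv ι ℝ)).trans
    (ContinuousLinearEquiv.sumPiEquivProdPi ℝ σ ι fun _ => ℝ).symm

theorem lagrangeCoords_apply (p : EuclideanSpace ℝ σ) (lam : EuclideanSpace ℝ ι) :
    lagrangeCoords σ ι (p, lam) = Sum.elim (fun s => p s) fun j => lam j := by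
  ext (s | j) <;> rfl

theorem evalSystem_lagrangeSystem (h : ι → MvPolynomial σ ℝ) (c p : EuclideanSpace ℝ σ)
    (lam : EuclideanSpace ℝ ι) :
    evalSystem ℝ (lagrangeSystem h fun s => c s) (lagrangeCoords σ ι (p, lam)) =
      lagrangeCoords σ ι (lagrangeMap (polynomialMap h) (p, lam) - (c, 0)) := by
  rw [lagrangeMap, Prod.mk_sub_mk, adjoint_fderiv_polynomialMap_apply, lagrangeCoords_apply,
    lagrangeCoords_apply]
  ext (s | j)
  · simp only [evalSystem, lagrangeSystem, map_sub, map_sum, map_mul, MvPolynomial.aeval_X,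
      MvPolynomial.aeval_C, MvPolynomial.aeval_rename, Sum.elim_inl, Sum.elim_inr,
      Sum.elim_comp_inl, jacobianMatrix, mul_comm]
    exact sub_right_comm _ _ _
  · simp [evalSystem, lagrangeSystem, MvPolynomial.aeval_rename, polynomialMap]

theorem isZeroOf_lagrangeSystem_iff :
    IsZeroOf ℝ (lagrangeSystem h fun s => c s) (Sum.elim (fun s => p s) fun j => lam j) ↔
      lagrangeMap (polynomialMap h) (p, lam) = (c, 0) := by
  rw [isZeroOf_iff_evalSystem_eq_zero, ← lagrangeCoords_apply, evalSystem_lagrangeSystem,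
    map_eq_zero_iff _ (lagrangeCoords σ ι).injective, sub_eq_zero]

theorem isSimpleZero_lagrangeSystem [DecidableEq σ] [DecidableEq ι]
    (hzero : lagrangeMap (polynomialMap h) (p, lam) = (c, 0))
    (hinj : Function.Injective (fderiv ℝ (lagrangeMap (polynomialMap h)) (p, lam))) :
    IsSimpleZero (lagrangeSystem h fun s => c s) (Sum.elim (fun s => p s) fun j => lam j) := by
  refine isSimpleZero_iff.2 ⟨isZeroOf_lagrangeSystem_iff.2 hzero, ?_⟩
  set e := lagrangeCoords σ ι
  have hconj : evalSystem ℝ (lagrangeSystem h fun s => c s) ∘ e =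
      e ∘ fun z => lagrangeMap (polynomialMap h) z - (c, 0) :=
    funext fun z => evalSystem_lagrangeSystem h c z.1 z.2
  have hderiv := congrArg (fun f => fderiv ℝ f (p, lam)) hconj
  simp only [e.comp_right_fderiv, e.comp_fderiv, fderiv_sub_const] at hderiv
  rw [← lagrangeCoords_apply]
  refine Function.Injective.of_comp_right (g := e) ?_ e.surjective
  have hcomp : fderiv ℝ (evalSystem ℝ (lagrangeSystem h fun s => c s)) (e (p, lam)) ∘ e =
      e ∘ fderiv ℝ (lagrangeMap (polynomialMap h)) (p, lam) := congrArg DFunLike.coe hderiv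
  rw [hcomp]
  exact e.injective.comp hinj

theorem multiplier_unique (hp : LinearIndependent ℝ (jacobianMatrix ℝ h p).row)
    (hlam : lagrangeMap (polynomialMap h) (p, lam) = (c, 0))
    (hmu : lagrangeMap (polynomialMap h) (p, mu) = (c, 0)) : mu = lam := by
  refine injective_adjoint_iff_surjective.2 (surjective_fderiv_polynomialMap hp) ?_
  exact sub_right_injective (congrArg Prod.fst (hmu.trans hlam.symm))

end LagrangeSystem

section SlackSystem

open MvPolynomial

theorem pderiv_inr_rename_inl {R τ υ : Type*} [CommSemiring R] (i : υ) (P : MvPolynomial τ R) :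
    pderiv (Sum.inr i) (rename (Sum.inl : τ → τ ⊕ υ) P) = 0 := by
  classical
  refine pderiv_eq_zero_of_notMem_vars fun hi => ?_
  obtain ⟨_, -, ⟨⟩⟩ := Finset.mem_image.1 (vars_rename Sum.inl P hi)

variable {n k : ℕ} (f : Fin k → MvPolynomial (Fin n) ℝ) {β : ℝ}

theorem jacobianMatrix_slackSystem_inr (z : Fin n ⊕ Fin k → ℝ) (i j : Fin k) :
    jacobianMatrix ℝ (slackSystem f β) z j (Sum.inr i) = if j = i then 1 / √β else 0 := by
  rcases eq_or_ne j i with rfl | hji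
  · simp [jacobianMatrix, slackSystem, pderiv_inr_rename_inl]
  · simp [jacobianMatrix, slackSystem, pderiv_inr_rename_inl, hji]

theorem linearIndependent_row_jacobianMatrix_slackSystem (hβ : 0 < β) (z : Fin n ⊕ Fin k → ℝ) :
    LinearIndependent ℝ (jacobianMatrix ℝ (slackSystem f β) z).row := by
  refine Fintype.linearIndependent_iff.2 fun lam hlam i => ?_
  have hinr := congrFun hlam (Sum.inr i)
  simpa [jacobianMatrix_slackSystem_inr, (Real.sqrt_pos.2 hβ).ne'] using hinr

end SlackSystem

end

theorem mainTheorem3_general {σ ι : Type*} [Fintype σ] [DecidableEq σ] [Fintype ι] [DecidableEq ι]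
    {d : ℕ} (h : ι → MvPolynomial σ ℝ) (hd : d + Fintype.card ι = Fintype.card σ)
    (hreg : ∀ p ∈ realZeroSet h, LinearIndependent ℝ (jacobianMatrix ℝ h p).row) :
    IsEmbeddedSubmanifold d (realZeroSet h) ∧
    ∃ U : Set (EuclideanSpace ℝ σ),
      IsTubularNeighborhood (realZeroSet h) U ∧
      ∀ c ∈ U, ∃ p : EuclideanSpace ℝ σ,
        IsClosestPoint (realZeroSet h) c p ∧
        (∀ p', IsClosestPoint (realZeroSet h) c p' → p' = p) ∧
        ∃ lam : ι → ℝ,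
          IsIsolatedZero (lagrangeSystem h (fun s => c s)) (Sum.elim (fun s => p s) lam) ∧
          IsSimpleZero (lagrangeSystem h (fun s => c s)) (Sum.elim (fun s => p s) lam) ∧
          ∀ lam' : ι → ℝ,
            IsZeroOf ℝ (lagrangeSystem h (fun s => c s)) (Sum.elim (fun s => p s) lam') →
              lam' = lam := by
  have hsmooth : ContDiff ℝ ∞ (polynomialMap h) := contDiff_polynomialMap h
  rw [realZeroSet_eq] at hreg ⊢
  have hsurj p (hp : polynomialMap h p = 0) := surjective_fderiv_polynomialMap (hreg p hp)
  refine ⟨isEmbeddedSubmanifold_zeroSet hsmooth hsurj (by simpa using hd), _,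
    isTubularNeighborhood_zeroSet hsmooth hsurj, ?_⟩
  rintro _ ⟨q, hq, rfl⟩
  obtain ⟨hclosest, hunique⟩ := isClosestPoint_of_mem_normalTube hsmooth hsurj hq
  obtain ⟨lam, hfoot, hinj⟩ :=
    exists_injective_fderiv_lagrangeMap_of_mem_normalTube hsmooth hsurj hq
  have hzero : lagrangeMap (polynomialMap h) (q.1, lam) = (q.1 + q.2, 0) :=
    Prod.ext hfoot.symm hq.1.1
  have hsimple := isSimpleZero_lagrangeSystem hzero hinj
  refine ⟨q.1, hclosest, hunique, lam, hsimple.isIsolatedZero, hsimple, fun lam' hlam' => ?_⟩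
  have hzero' := isZeroOf_lagrangeSystem_iff (lam := WithLp.toLp 2 lam').1 hlam'
  exact congrArg WithLp.ofLp (multiplier_unique (hreg q.1 hq.1.1) hzero hzero')

theorem mainTheorem3 (n k : ℕ) (f : Fin k → MvPolynomial (Fin n) ℝ) (β : ℝ) (hβ : 0 < β) :
    IsEmbeddedSubmanifold n (realZeroSet (slackSystem f β)) ∧
    ∃ U : Set (EuclideanSpace ℝ (Fin n ⊕ Fin k)),
      IsTubularNeighborhood (realZeroSet (slackSystem f β)) U ∧
      ∀ c ∈ U, ∃ p : EuclideanSpace ℝ (Fin n ⊕ Fin k),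
        IsClosestPoint (realZeroSet (slackSystem f β)) c p ∧
        (∀ p', IsClosestPoint (realZeroSet (slackSystem f β)) c p' → p' = p) ∧
        ∃ lam : Fin k → ℝ,
          IsIsolatedZero (lagrangeSystem (slackSystem f β) (fun s => c s))
            (Sum.elim (fun s => p s) lam) ∧
          IsSimpleZero (lagrangeSystem (slackSystem f β) (fun s => c s))
            (Sum.elim (fun s => p s) lam) ∧
          ∀ lam' : Fin k → ℝ,
            IsZeroOf ℝ (lagrangeSystem (slackSystem f β) (fun s => c s))
              (Sum.elim (fun s => p s) lam') → lam' = lam :=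
  mainTheorem3_general (slackSystem f β) (by simp)
    fun p _ => linearIndependent_row_jacobianMatrix_slackSystem f hβ p
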